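/- Let $0<\delta<\frac12$ and $c\in\mathbb R$. Then, up to isomorphism, there are only finitely many finite simple graphs $G$ with $n\ge 2$ vertices (for any $n$) such that every vertex of $G$ has degree exactly $\delta n$ and $\lambda_2(G)<c$, where $\lambda_1(G)\ge\lambda_2(G)\ge\dots\ge\lambda_n(G)$ are the eigenvalues of the adjacency matrix of $G$, listed with multiplicity. -/

import Mathlib

/-- The second largest eigenvalue `λ₂`, counted with multiplicity, of the (real, symmetric)
adjacency matrix of a finite simple graph with at least two vertices:
`Matrix.IsHermitian.eigenvalues₀` lists the eigenvalues with multiplicity in decreasing order,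
`λ₁ ≥ λ₂ ≥ … ≥ λₙ`, indexed from `0`. -/
noncomputable def SimpleGraph.secondEigenvalue {V : Type*} [Fintype V] [DecidableEq V]
    (G : SimpleGraph V) [DecidableRel G.Adj] (hV : 2 ≤ Fintype.card V) : ℝ :=
  Matrix.IsHermitian.eigenvalues₀ (A := G.adjMatrix ℝ)
    ((Matrix.conjTranspose_eq_transpose_of_trivial (G.adjMatrix ℝ)).trans
      (G.isSymm_adjMatrix (α := ℝ))) ⟨1, hV⟩

open Finset Matrix

/-! For a `d`-regular graph the all-ones vector spans the top eigenspace when `λ₂ < c ≤ d`, so with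
`d = δn` the adjacency form is at most `c‖x‖² + δ(∑ x)²` (`AdjFormLE`). If `n` is large, Ramsey
gives a large clique or independent set, and test vectors rule out both. A clique violates the bound
directly. From an independent set `I` of size `m`, `card_le_of_lt_card` extracts `m` vertices almost
completely joined to `I`; this near-complete bipartite pair has density about 1/2 > `δ`, too dense
for the bound. Hence `n` is bounded. -/

/-- **Ramsey's theorem** for graphs, with an exponential bound. -/
theorem SimpleGraph.exists_isNClique_or_isNIndepSet {V : Type*} [DecidableEq V]
    (G : SimpleGraph V) [DecidableRel G.Adj] (k s t : ℕ) (hk : s + t ≤ k) (W : Finset V)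
    (hW : 2 ^ k ≤ #W) :
    (∃ S ⊆ W, G.IsNClique s S) ∨ ∃ S ⊆ W, G.IsNIndepSet t S := by
  induction k generalizing s t W with
  | zero =>
    obtain rfl : s = 0 := by omega
    exact Or.inl ⟨∅, by simp, by simp⟩
  | succ k ih =>
    rcases s with _ | s
    · exact Or.inl ⟨∅, by simp, by simp⟩
    rcases t with _ | t
    · exact Or.inr ⟨∅, by simp, by simp [isNIndepSet_iff]⟩
    obtain ⟨v, hv⟩ : W.Nonempty := card_pos.1 (lt_of_lt_of_le (by positivity) hW)
    have hsplit := card_filter_add_card_filter_not (s := W.erase v) (fun w => G.Adj v w)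
    rw [card_erase_of_mem hv] at hsplit
    rw [pow_succ] at hW
    rcases le_or_gt (2 ^ k) #{w ∈ W.erase v | G.Adj v w} with h | h
    · rcases ih s (t + 1) (by omega) _ h with ⟨S, hS, hc⟩ | ⟨S, hS, hc⟩
      · refine Or.inl ⟨insert v S, ?_, hc.insert fun b hb => (mem_filter.1 (hS hb)).2⟩
        refine insert_subset hv (hS.trans ((filter_subset _ _).trans (erase_subset _ _)))
      · exact Or.inr ⟨S, hS.trans ((filter_subset _ _).trans (erase_subset _ _)), hc⟩
    · have h' : 2 ^ k ≤ #{w ∈ W.erase v | ¬ G.Adj v w} := by omega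
      rcases ih (s + 1) t (by omega) _ h' with ⟨S, hS, hc⟩ | ⟨S, hS, hc⟩
      · exact Or.inl ⟨S, hS.trans ((filter_subset _ _).trans (erase_subset _ _)), hc⟩
      · refine Or.inr ⟨insert v S, ?_, ?_⟩
        · exact insert_subset hv (hS.trans ((filter_subset _ _).trans (erase_subset _ _)))
        · rw [← isNClique_compl] at hc ⊢
          refine hc.insert fun b hb => ?_
          have := mem_filter.1 (hS hb)
          rw [compl_adj]
          exact ⟨(mem_erase.1 this.1).1.symm, this.2⟩

/-! ### Spectral bound on the adjacency form -/

theorem Matrix.IsHermitian.inner_eigenvectorBasis_mulVec {V : Type*} [Fintype V] [DecidableEq V]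
    {A : Matrix V V ℝ} (hA : A.IsHermitian) (i : V) (x : V → ℝ) :
    ⇑(hA.eigenvectorBasis i) ⬝ᵥ A *ᵥ x =
      hA.eigenvalues i * (⇑(hA.eigenvectorBasis i) ⬝ᵥ x) := by
  have hT : Aᵀ = A := by rw [← conjTranspose_eq_transpose_of_trivial]; exact hA
  rw [dotProduct_mulVec, ← mulVec_transpose, hT, hA.mulVec_eigenvectorBasis, smul_dotProduct,
    smul_eq_mul]

theorem OrthonormalBasis.dotProduct_eq_sum {V : Type*} [Fintype V]
    (b : OrthonormalBasis V ℝ (EuclideanSpace ℝ V)) (x y : V → ℝ) :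
    x ⬝ᵥ y = ∑ i, (⇑(b i) ⬝ᵥ x) * (⇑(b i) ⬝ᵥ y) := by
  have h := b.sum_inner_mul_inner (WithLp.toLp 2 x) (WithLp.toLp 2 y)
  simp only [EuclideanSpace.inner_eq_star_dotProduct, star_trivial] at h
  rw [dotProduct_comm x y, ← h]
  exact sum_congr rfl fun i _ => by rw [dotProduct_comm y]

/-- The quadratic form of a regular graph, bounded in terms of its second eigenvalue. -/
theorem SimpleGraph.IsRegularOfDegree.dotProduct_adjMatrix_mulVec_le {V : Type*} [Fintype V]
    [DecidableEq V] {G : SimpleGraph V} [DecidableRel G.Adj] (hV : 2 ≤ Fintype.card V) {d : ℕ}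
    (hG : G.IsRegularOfDegree d) {c : ℝ} (hc : G.secondEigenvalue hV < c) (hcd : c ≤ d)
    (x : V → ℝ) :
    x ⬝ᵥ G.adjMatrix ℝ *ᵥ x ≤
      c * (x ⬝ᵥ x) + (d - c) / Fintype.card V * (∑ v, x v) ^ 2 := by
  have hA : (G.adjMatrix ℝ).IsHermitian :=
    (Matrix.conjTranspose_eq_transpose_of_trivial (G.adjMatrix ℝ)).trans
      (G.isSymm_adjMatrix (α := ℝ))
  set A := G.adjMatrix ℝ
  set b := hA.eigenvectorBasis
  set e : Fin (Fintype.card V) ≃ V := Fintype.equivOfCardEq (Fintype.card_fin _)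
  -- `o` carries `λ₁`; every other index has position at least 1, hence eigenvalue at most `λ₂`.
  set o : V := e ⟨0, by omega⟩
  have hlt : ∀ i, i ≠ o → hA.eigenvalues i < c := by
    intro i hi
    refine lt_of_le_of_lt (hA.eigenvalues₀_antitone (?_ : ⟨1, hV⟩ ≤ e.symm i)) hc
    rw [Fin.le_def]
    by_contra hcon
    refine hi ((e.symm_apply_eq).1 (Fin.ext ?_))
    change ¬ 1 ≤ (e.symm i : ℕ) at hcon
    change (e.symm i : ℕ) = 0
    omega
  set u : V → ℝ := fun _ => 1
  have hu : A *ᵥ u = (d : ℝ) • u := by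
    ext v
    have := adjMatrix_mulVec_const_apply_of_regular (α := ℝ) (a := 1) hG (v := v)
    simpa [u, A] using this
  -- Eigenvectors for distinct eigenvalues `d ≥ c > λᵢ` are orthogonal, so `b o` is parallel to `u`.
  have horth : ∀ i, i ≠ o → ⇑(b i) ⬝ᵥ u = 0 := by
    intro i hi
    have h1 := hA.inner_eigenvectorBasis_mulVec i u
    rw [hu, dotProduct_smul, smul_eq_mul] at h1
    have h2 := hlt i hi
    have h3 : ((d : ℝ) - hA.eigenvalues i) * (⇑(b i) ⬝ᵥ u) = 0 := by linarith
    exact (mul_eq_zero.1 h3).resolve_left (by linarith)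
  have hdotu : ∀ y : V → ℝ, u ⬝ᵥ y = (⇑(b o) ⬝ᵥ u) * (⇑(b o) ⬝ᵥ y) := by
    intro y
    rw [b.dotProduct_eq_sum, sum_eq_single o (fun i _ hi => by rw [horth i hi, zero_mul])
      (by simp)]
  have hn : (⇑(b o) ⬝ᵥ u) * (⇑(b o) ⬝ᵥ u) = Fintype.card V := by
    rw [← hdotu]; simp [u, dotProduct]
  have hn0 : (0 : ℝ) < Fintype.card V := by exact_mod_cast (by omega : 0 < Fintype.card V)
  have hev : hA.eigenvalues o = d := by
    have h1 := hA.inner_eigenvectorBasis_mulVec o u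
    rw [hu, dotProduct_smul, smul_eq_mul] at h1
    refine (mul_right_cancel₀ (fun h0 => ?_) h1).symm
    change ⇑(b o) ⬝ᵥ u = 0 at h0
    rw [h0] at hn
    linarith
  have hsum : ∑ v, x v = (⇑(b o) ⬝ᵥ u) * (⇑(b o) ⬝ᵥ x) := by
    rw [← hdotu]; simp [u, dotProduct]
  have hsq : (d - c) / Fintype.card V * (∑ v, x v) ^ 2 = (d - c) * (⇑(b o) ⬝ᵥ x) ^ 2 := by
    rw [hsum, mul_pow, sq (⇑(b o) ⬝ᵥ u), hn]
    field_simp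
  rw [hsq, b.dotProduct_eq_sum x (A *ᵥ x), b.dotProduct_eq_sum x x, mul_sum,
    ← add_sum_erase _ _ (mem_univ o), ← add_sum_erase _ (fun i => c * _) (mem_univ o)]
  have hrest : ∑ i ∈ univ.erase o, (⇑(b i) ⬝ᵥ x) * (⇑(b i) ⬝ᵥ A *ᵥ x) ≤
      ∑ i ∈ univ.erase o, c * ((⇑(b i) ⬝ᵥ x) * (⇑(b i) ⬝ᵥ x)) := by
    refine sum_le_sum fun i hi => ?_
    rw [hA.inner_eigenvectorBasis_mulVec i x]
    have := mul_le_mul_of_nonneg_right (hlt i (mem_erase.1 hi).1).le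
      (mul_self_nonneg (⇑(b i) ⬝ᵥ x))
    change (⇑(b i) ⬝ᵥ x) * (hA.eigenvalues i * (⇑(b i) ⬝ᵥ x)) ≤ _
    linarith
  have ho : ⇑(b o) ⬝ᵥ A *ᵥ x = d * (⇑(b o) ⬝ᵥ x) := by
    rw [← hev]; exact hA.inner_eigenvectorBasis_mulVec o x
  rw [ho]
  linarith

/-! ### Cliques and independent sets via test vectors -/

/-- The quadratic form of the adjacency matrix is bounded by `c * ‖x‖² + δ * (∑ x)²`. -/
def SimpleGraph.AdjFormLE {V : Type*} [Fintype V] (G : SimpleGraph V) [DecidableRel G.Adj]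
    (c δ : ℝ) : Prop :=
  ∀ x : V → ℝ, x ⬝ᵥ G.adjMatrix ℝ *ᵥ x ≤ c * (x ⬝ᵥ x) + δ * (∑ v, x v) ^ 2

/-- The real-valued characteristic vector of a finite set. -/
def Finset.charVec {V : Type*} [DecidableEq V] (S : Finset V) : V → ℝ :=
  fun v => if v ∈ S then 1 else 0

section charVec

variable {V : Type*} [Fintype V] [DecidableEq V]

theorem Finset.charVec_dotProduct (S : Finset V) (x : V → ℝ) :
    S.charVec ⬝ᵥ x = ∑ v ∈ S, x v := by
  simp [charVec, dotProduct]

theorem Finset.charVec_dotProduct_charVec (S T : Finset V) :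
    S.charVec ⬝ᵥ T.charVec = #(S ∩ T) := by
  rw [charVec_dotProduct]
  simp [charVec]

theorem Finset.sum_charVec (S : Finset V) : ∑ v, S.charVec v = #S := by
  simp [charVec]

variable (G : SimpleGraph V) [DecidableRel G.Adj]

theorem SimpleGraph.charVec_dotProduct_adjMatrix_mulVec (S T : Finset V) :
    S.charVec ⬝ᵥ G.adjMatrix ℝ *ᵥ T.charVec =
      ∑ v ∈ S, (#{w ∈ T | G.Adj v w} : ℝ) := by
  rw [charVec_dotProduct]
  refine sum_congr rfl fun v _ => ?_
  simp [charVec, mulVec, dotProduct, adjMatrix_apply, ← ite_and, ← filter_filter]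

theorem SimpleGraph.charVec_dotProduct_adjMatrix_mulVec_comm (S T : Finset V) :
    S.charVec ⬝ᵥ G.adjMatrix ℝ *ᵥ T.charVec = T.charVec ⬝ᵥ G.adjMatrix ℝ *ᵥ S.charVec := by
  rw [dotProduct_mulVec, ← mulVec_transpose, transpose_adjMatrix, dotProduct_comm]

theorem SimpleGraph.charVec_dotProduct_adjMatrix_mulVec_nonneg (S T : Finset V) :
    0 ≤ S.charVec ⬝ᵥ G.adjMatrix ℝ *ᵥ T.charVec := by
  rw [charVec_dotProduct_adjMatrix_mulVec]
  positivity

variable {G} {c δ : ℝ}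

theorem SimpleGraph.AdjFormLE.card_clique_le (h : G.AdjFormLE c δ) {k : ℕ} {S : Finset V}
    (hS : G.IsNClique k S) (hk : 0 < k) : k * (1 - δ) ≤ c + 1 := by
  have h1 := h S.charVec
  rw [charVec_dotProduct_adjMatrix_mulVec, charVec_dotProduct_charVec, sum_charVec,
    inter_self, hS.card_eq] at h1
  have h2 : ∀ v ∈ S, (#{w ∈ S | G.Adj v w} : ℝ) = k - 1 := by
    intro v hv
    have : {w ∈ S | G.Adj v w} = S.erase v := by
      ext w
      simp only [mem_filter, mem_erase]
      exact ⟨fun h => ⟨h.2.ne', h.1⟩, fun h => ⟨h.2, hS.isClique hv h.2 h.1.symm⟩⟩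
    rw [this, card_erase_of_mem hv, hS.card_eq, Nat.cast_sub hk, Nat.cast_one]
  rw [sum_congr rfl h2, sum_const, hS.card_eq, nsmul_eq_mul] at h1
  have hk' : (0 : ℝ) < k := by exact_mod_cast hk
  refine le_of_mul_le_mul_left ?_ hk'
  linarith

/-- A vertex is joined to few or to almost all vertices of an independent set. -/
theorem SimpleGraph.AdjFormLE.card_adj_lt_or (h : G.AdjFormLE c δ) (hc : 1 ≤ c) (hδ : δ ≤ 1)
    {L m : ℕ} (hL : 2 * c ^ 2 + 2 * c < L) {I : Finset V} (hI : G.IsNIndepSet m I) (v : V) :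
    #{w ∈ I | G.Adj v w} < L ∨ m < #{w ∈ I | G.Adj v w} + L := by
  by_contra! hcon
  obtain ⟨h1, h2⟩ := hcon
  have h3 := card_filter_add_card_filter_not (s := I) (fun w => G.Adj v w)
  rw [hI.card_eq] at h3
  obtain ⟨P, hP, hPc⟩ := exists_subset_card_eq h1
  obtain ⟨Q, hQ, hQc⟩ := exists_subset_card_eq (show L ≤ #{w ∈ I | ¬ G.Adj v w} by omega)
  have hPI : P ⊆ I := hP.trans (filter_subset _ _)
  have hQI : Q ⊆ I := hQ.trans (filter_subset _ _)
  have hvP : ∀ w ∈ P, G.Adj v w := fun w hw => (mem_filter.1 (hP hw)).2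
  have hvQ : ∀ w ∈ Q, ¬ G.Adj v w := fun w hw => (mem_filter.1 (hQ hw)).2
  have hind : ∀ a ∈ I, ∀ b ∈ I, ¬ G.Adj a b := fun a ha b hb hab =>
    hI.isIndepSet ha hb hab.ne hab
  have hL0 : 0 < L := by
    have : (0 : ℝ) < L := by nlinarith
    exact_mod_cast this
  have hvI : v ∉ I := by
    obtain ⟨w, hw⟩ : P.Nonempty := card_pos.1 (by omega)
    exact fun hv => hind v hv w (hPI hw) (hvP w hw)
  have hII : ∀ S ⊆ I, ∀ T ⊆ I, S.charVec ⬝ᵥ G.adjMatrix ℝ *ᵥ T.charVec = 0 := by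
    intro S hS T hT
    rw [charVec_dotProduct_adjMatrix_mulVec]
    refine sum_eq_zero fun a ha => ?_
    rw [filter_eq_empty_iff.2 fun b hb => hind a (hS ha) b (hT hb)]
    simp
  have hvv : ({v} : Finset V).charVec ⬝ᵥ G.adjMatrix ℝ *ᵥ ({v} : Finset V).charVec = 0 := by
    simp [charVec_dotProduct_adjMatrix_mulVec, filter_singleton]
  have hvP' : ({v} : Finset V).charVec ⬝ᵥ G.adjMatrix ℝ *ᵥ P.charVec = L := by
    rw [charVec_dotProduct_adjMatrix_mulVec, sum_singleton, filter_true_of_mem hvP, hPc]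
  have hvQ' : ({v} : Finset V).charVec ⬝ᵥ G.adjMatrix ℝ *ᵥ Q.charVec = 0 := by
    rw [charVec_dotProduct_adjMatrix_mulVec, sum_singleton, filter_false_of_mem hvQ]
    simp
  have hPQ : P ∩ Q = ∅ := by
    ext w
    simp only [mem_inter, notMem_empty, iff_false]
    exact fun hw => hvQ w hw.2 (hvP w hw.1)
  have hdvP : ({v} : Finset V) ∩ P = ∅ := singleton_inter_of_notMem fun hv => hvI (hPI hv)
  have hdvQ : ({v} : Finset V) ∩ Q = ∅ := singleton_inter_of_notMem fun hv => hvI (hQI hv)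
  -- The entries of `P` and `Q` cancel in the sum, leaving `2c`. The bound reads `4cL ≤ c(4c² + 2L)
  -- + 4δc²`, which forces `L ≤ 2c² + 2c`.
  have key := h ((2 * c) • ({v} : Finset V).charVec + P.charVec - Q.charVec)
  simp only [mulVec_add, mulVec_sub, mulVec_smul, add_dotProduct, sub_dotProduct, smul_dotProduct,
    dotProduct_add, dotProduct_sub, dotProduct_smul, hII P hPI P hPI, hII P hPI Q hQI,
    hII Q hQI P hPI, hII Q hQI Q hQI, hvv, hvP', hvQ',
    G.charVec_dotProduct_adjMatrix_mulVec_comm P {v},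
    G.charVec_dotProduct_adjMatrix_mulVec_comm Q {v}, charVec_dotProduct_charVec,
    inter_comm P {v}, inter_comm Q {v}, inter_comm Q P, hPQ, hdvP, hdvQ, inter_self,
    Pi.add_apply, Pi.sub_apply, Pi.smul_apply, smul_eq_mul, sum_add_distrib, sum_sub_distrib, ← mul_sum,
    sum_charVec, card_singleton, card_empty, hPc, hQc] at key
  push_cast at key
  have hc0 : 0 < c := by linarith
  have : 2 * c * L ≤ 2 * c * (2 * c ^ 2 + 2 * c) := by
    have : δ * c ^ 2 ≤ 1 * c ^ 2 := by gcongr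
    nlinarith
  have := le_of_mul_le_mul_left this (by positivity)
  linarith

/-- Double counting of the edges leaving an independent set gives many vertices which are
joined to almost all of it. -/
theorem SimpleGraph.AdjFormLE.card_le_of_lt_card (h : G.AdjFormLE c δ) (hc : 1 ≤ c) (hδ : δ ≤ 1)
    {L m d : ℕ} (hL : 2 * c ^ 2 + 2 * c < L) (hLm : 2 * L ≤ δ * m)
    (hd : (d : ℝ) = δ * Fintype.card V) (hG : G.IsRegularOfDegree d)
    (hn : 2 * m < δ * Fintype.card V)
    {I : Finset V} (hI : G.IsNIndepSet m I) :
    m ≤ #{v | m < #{w ∈ I | G.Adj v w} + L} := by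
  by_contra! hcon
  have hL0 : (0 : ℝ) < L := by nlinarith
  have hm : (0 : ℝ) < m := by
    by_contra! hm
    nlinarith
  have h1 : ((univ : Finset V).charVec ⬝ᵥ G.adjMatrix ℝ *ᵥ I.charVec) = m * d := by
    rw [charVec_dotProduct_adjMatrix_mulVec_comm, charVec_dotProduct_adjMatrix_mulVec]
    have : ∀ v ∈ I, (#{w | G.Adj v w} : ℝ) = d := by
      intro v _
      rw [← hG.degree_eq v, ← card_neighborFinset_eq_degree, neighborFinset_eq_filter]
    rw [sum_congr rfl this, sum_const, hI.card_eq, nsmul_eq_mul]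
  rw [charVec_dotProduct_adjMatrix_mulVec] at h1
  have h2 : ∑ v, (#{w ∈ I | G.Adj v w} : ℝ) ≤
      ∑ v, ((if m < #{w ∈ I | G.Adj v w} + L then (m : ℝ) else 0) + L) := by
    refine sum_le_sum fun v _ => ?_
    split_ifs with hv
    · have : #{w ∈ I | G.Adj v w} ≤ m := (card_filter_le _ _).trans hI.card_eq.le
      have : (#{w ∈ I | G.Adj v w} : ℝ) ≤ m := by exact_mod_cast this
      linarith
    · rw [zero_add]
      exact_mod_cast ((h.card_adj_lt_or hc hδ hL hI v).resolve_right hv).le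
  rw [sum_add_distrib, ← sum_filter, sum_const, sum_const, nsmul_eq_mul, nsmul_eq_mul, h1,
    card_univ, hd] at h2
  -- Since `L ≤ δm/2`, the count forces at least `δn/2 > m` such vertices.
  have h3 : (#{v | m < #{w ∈ I | G.Adj v w} + L} : ℝ) ≤ m := by exact_mod_cast hcon.le
  have h4 := mul_le_mul_of_nonneg_right h3 hm.le
  have h5 := mul_le_mul_of_nonneg_right hLm (Nat.cast_nonneg (α := ℝ) (Fintype.card V))
  have h6 := mul_lt_mul_of_pos_left hn hm
  nlinarith

/-- Testing on `I + B`, with `B` consisting of `m` vertices almost completely joined to `I`, gives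
`2m(m - L) ≤ 2cm + 4δm²`, against `hm`. This is where `δ < 1/2` matters. -/
theorem SimpleGraph.AdjFormLE.false_of_isNIndepSet (h : G.AdjFormLE c δ) (hc : 1 ≤ c)
    (hδ : δ ≤ 1) {L m d : ℕ} (hL : 2 * c ^ 2 + 2 * c < L)
    (hLm : 2 * L ≤ δ * m) (hm : c + L < m * (1 - 2 * δ))
    (hd : (d : ℝ) = δ * Fintype.card V) (hG : G.IsRegularOfDegree d)
    (hn : 2 * m < δ * Fintype.card V)
    {I : Finset V} (hI : G.IsNIndepSet m I) : False := by
  obtain ⟨B, hB, hBc⟩ := exists_subset_card_eq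
    (h.card_le_of_lt_card hc hδ hL hLm hd hG hn hI)
  have hB' : ∀ v ∈ B, m < #{w ∈ I | G.Adj v w} + L := fun v hv => (mem_filter.1 (hB hv)).2
  have hm0 : (0 : ℝ) < m := by
    have hL0 : (0 : ℝ) < L := by nlinarith
    by_contra! hm
    nlinarith
  have hLm' : L ≤ m := by
    have : (L : ℝ) ≤ m := by nlinarith
    exact_mod_cast this
  have hdisj : I ∩ B = ∅ := by
    ext v
    simp only [mem_inter, notMem_empty, iff_false]
    rintro ⟨hvI, hvB⟩
    have := hB' v hvB
    rw [filter_false_of_mem fun w hw hvw => hI.isIndepSet hvI hw hvw.ne hvw] at this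
    simp at this
    omega
  have hBI : (m : ℝ) * (m - L) ≤ B.charVec ⬝ᵥ G.adjMatrix ℝ *ᵥ I.charVec := by
    rw [charVec_dotProduct_adjMatrix_mulVec]
    calc (m : ℝ) * (m - L) = ∑ v ∈ B, ((m : ℝ) - L) := by rw [sum_const, hBc, nsmul_eq_mul]
      _ ≤ _ := sum_le_sum fun v hv => by
        have : (m : ℝ) < #{w ∈ I | G.Adj v w} + L := by exact_mod_cast hB' v hv
        linarith
  have key := h (I.charVec + B.charVec)
  have h1 := G.charVec_dotProduct_adjMatrix_mulVec_nonneg I I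
  have h2 := G.charVec_dotProduct_adjMatrix_mulVec_nonneg B B
  simp only [mulVec_add, add_dotProduct, dotProduct_add, charVec_dotProduct_charVec,
    G.charVec_dotProduct_adjMatrix_mulVec_comm I B, inter_comm B I, hdisj, inter_self,
    Pi.add_apply, sum_add_distrib, sum_charVec, card_empty, hI.card_eq, hBc] at key
  push_cast at key
  have h3 := mul_lt_mul_of_pos_left hm hm0
  nlinarith

end charVec

/-! ### Choice of constants and finiteness -/

theorem SimpleGraph.exists_card_le_of_secondEigenvalue_lt (δ : ℝ) (hδ₀ : 0 < δ)
    (hδ₁ : δ < 1 / 2) (c : ℝ) :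
    ∃ N : ℕ, ∀ (V : Type*) [Fintype V] [DecidableEq V] (G : SimpleGraph V) [DecidableRel G.Adj]
      (hV : 2 ≤ Fintype.card V) (d : ℕ), (d : ℝ) = δ * Fintype.card V →
      G.IsRegularOfDegree d → G.secondEigenvalue hV < c → Fintype.card V ≤ N := by
  set c' := max c 1
  have hc' : 1 ≤ c' := le_max_right _ _
  obtain ⟨L, hL⟩ := exists_nat_gt (2 * c' ^ 2 + 2 * c')
  obtain ⟨m, hm⟩ := exists_nat_gt (max (2 * L / δ) ((c' + L) / (1 - 2 * δ)))
  -- As `1 - δ > 1/2`, this `k` exceeds the clique bound.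
  obtain ⟨k, hk⟩ := exists_nat_gt (2 * (c' + 1))
  -- The first term ensures `c' ≤ d`, the second the vertex count `2m < δn`.
  obtain ⟨n₀, hn₀⟩ := exists_nat_gt (max (c' / δ) (2 * m / δ))
  refine ⟨max n₀ (2 ^ (k + m)), fun V _ _ G _ hV d hd hG hlt => ?_⟩
  by_contra! hcard
  have hn₀' : (n₀ : ℝ) < Fintype.card V := by
    exact_mod_cast (le_max_left _ _).trans_lt hcard
  have hcn := ((le_max_left _ _).trans_lt hn₀).trans hn₀'
  have hmn := ((le_max_right _ _).trans_lt hn₀).trans hn₀'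
  have hLm := (le_max_left _ _).trans_lt hm
  have hcm := (le_max_right _ _).trans_lt hm
  rw [div_lt_iff₀' hδ₀] at hcn hmn hLm
  rw [div_lt_iff₀ (by linarith)] at hcm
  have hn : (0 : ℝ) < Fintype.card V := by exact_mod_cast (by omega : 0 < Fintype.card V)
  have hform : G.AdjFormLE c' δ := by
    intro x
    refine (hG.dotProduct_adjMatrix_mulVec_le hV (hlt.trans_le (le_max_left _ _))
      (by rw [hd]; exact hcn.le) x).trans ?_
    gcongr
    rw [div_le_iff₀ hn]
    linarith
  rcases G.exists_isNClique_or_isNIndepSet (k + m) k m le_rfl univ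
    (by rw [card_univ]; exact (le_max_right _ _).trans hcard.le) with ⟨S, -, hS⟩ | ⟨S, -, hS⟩
  · have hk0 : (0 : ℝ) < k := by linarith
    have := hform.card_clique_le hS (by exact_mod_cast hk0)
    nlinarith
  · exact hform.false_of_isNIndepSet hc' (by linarith) hL hLm.le hcm hd hG hmn hS

theorem corollary4 (δ : ℝ) (hδ₀ : 0 < δ) (hδ₁ : δ < 1 / 2) (c : ℝ) :
    ∃ S : Set (Σ n : ℕ, SimpleGraph (Fin n)), S.Finite ∧
      ∀ (V : Type*) [Fintype V] [DecidableEq V] (G : SimpleGraph V) [DecidableRel G.Adj]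
        (hV : 2 ≤ Fintype.card V) (d : ℕ),
        (d : ℝ) = δ * (Fintype.card V : ℝ) →
        G.IsRegularOfDegree d →
        G.secondEigenvalue hV < c →
        ∃ H ∈ S, Nonempty (G ≃g H.2) := by
  obtain ⟨N, hN⟩ := SimpleGraph.exists_card_le_of_secondEigenvalue_lt δ hδ₀ hδ₁ c
  refine ⟨⋃ n ∈ Set.Iic N, Set.range (Sigma.mk n),
    (Set.finite_Iic N).biUnion fun _ _ => Set.finite_range _, fun V _ _ G _ hV d hd hG hlt => ?_⟩
  refine ⟨⟨Fintype.card V, G.map (Fintype.equivFin V).toEmbedding⟩,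
    Set.mem_biUnion (hN V G hV d hd hG hlt) (Set.mem_range_self _), ⟨SimpleGraph.Iso.map (Fintype.equivFin V) G⟩⟩
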